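/- Let $\mathbb{D}$ be the open unit disk of $\mathbb{C}$. A weight on $[0,1)$ is a non-decreasing, continuous, unbounded function $w:[0,1)\to(0,+\infty)$; it is log-convex if $x\mapsto\log w(e^x)$ is convex on $(-\infty,0)$. For $f$ holomorphic on $\mathbb{D}$ and $0\le r<1$ put $$M_p(f,r)=\Bigl(\frac1{2\pi}\int_0^{2\pi}|f(re^{i\theta})|^p\,d\theta\Bigr)^{1/p}\ (0<p<\infty),\qquad M_\infty(f,r)=\max_{0\le\theta<2\pi}|f(re^{i\theta})|,$$ and let the Hardy growth space $H_w^p(\mathbb{D})$ consist of all holomorphic $f$ on $\mathbb{D}$ with $\|f\|_{H_w^p}=\sup_{0\le r<1}M_p(f,r)/w(r)<\infty$. The differentiation operator $D:f\mapsto f'$ is called bounded from $H_w^p(\mathbb{D})$ to $H_u^p(\mathbb{D})$ if it maps $H_w^p(\mathbb{D})$ into $H_u^p(\mathbb{D})$ and there is a constant $C$ with $\|f'\|_{H_u^p}\le C\|f\|_{H_w^p}$ for all $f\in H_w^p(\mathbb{D})$. Let $w$ be a log-convex weight on $[0,1)$ and put $u(r)=w(r)/(1-r)$, $0\le r<1$.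 If $D:H_w^p(\mathbb{D})\to H_u^p(\mathbb{D})$ is bounded for some $1\le p\le\infty$, then $D:H_w^p(\mathbb{D})\to H_u^p(\mathbb{D})$ is bounded for all $1\le p\le\infty$. -/

import Mathlib

open Set
open scoped ENNReal

noncomputable section

namespace HardyGrowth

/-- A weight on `[0, 1)`: a positive, non-decreasing, continuous and unbounded function there
(values of `w` outside `[0, 1)` play no role). -/
structure IsWeight (w : ℝ → ℝ) : Prop where
  pos : ∀ r ∈ Ico (0 : ℝ) 1, 0 < w r
  mono : MonotoneOn w (Ico 0 1)
  cont : ContinuousOn w (Ico 0 1)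
  unbounded : ¬ BddAbove (w '' Ico 0 1)

/-- Log-convexity on `[0, 1)`: `log (w r)` is a convex function of `log r`, `0 < r < 1`. -/
def IsLogConvex (w : ℝ → ℝ) : Prop :=
  ConvexOn ℝ (Iio (0 : ℝ)) fun x => Real.log (w (Real.exp x))

/-- The integral mean `M_p(f, r)` of `f` over the circle of radius `r` centred at the origin;
for `p = ∞` it is the maximum of `|f|` over that circle. -/
def mean (p : ℝ≥0∞) (f : ℂ → ℂ) (r : ℝ) : ℝ :=
  if p = ∞ then sSup ((fun θ : ℝ => ‖f (r * Complex.exp (θ * Complex.I))‖) '' Ico 0 (2 * Real.pi))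
  else ((1 / (2 * Real.pi)) *
    ∫ θ in (0 : ℝ)..(2 * Real.pi), ‖f (r * Complex.exp (θ * Complex.I))‖ ^ p.toReal) ^
      (1 / p.toReal)

/-- The set of the quotients `M_p(f, r) / w(r)`, `0 ≤ r < 1`. -/
def quotients (p : ℝ≥0∞) (w : ℝ → ℝ) (f : ℂ → ℂ) : Set ℝ :=
  (fun r : ℝ => mean p f r / w r) '' Ico 0 1

/-- The norm of the Hardy growth space `H_w^p` of the unit disk. -/
def growthNorm (p : ℝ≥0∞) (w : ℝ → ℝ) (f : ℂ → ℂ) : ℝ :=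
  sSup (quotients p w f)

/-- The Hardy growth space `H_w^p` of the unit disk: the functions holomorphic on the unit disk
for which the supremum defining the norm is finite. -/
def growthSpace (p : ℝ≥0∞) (w : ℝ → ℝ) : Set (ℂ → ℂ) :=
  {f | DifferentiableOn ℂ f (Metric.ball 0 1) ∧ BddAbove (quotients p w f)}

/-- The differentiation operator maps `H_w^p` into `H_u^p` and is bounded. -/
def DiffBounded (p : ℝ≥0∞) (w u : ℝ → ℝ) : Prop :=
  ∃ C : ℝ, ∀ f ∈ growthSpace p w,
    deriv f ∈ growthSpace p u ∧ growthNorm p u (deriv f) ≤ C * growthNorm p w f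

end HardyGrowth

end

/-! The bridge between exponents is the doubling condition `w (r + (1 - r) / 2) ≤ K * w r`, which
does not involve `p`. Doubling is necessary: `z ^ n` has constant modulus on circles, so all its
means equal `r ^ n`. Testing on it at a maximum point `b` of `r ^ n / w r` gives `n * (1 - b) ≤ C`
(`DiffBounded.exists_isMax_pow_div`). Log-convexity bounds the logarithmic slope of `w` by `n` to
the left of `b`; for `n` of order `1 / (1 - r)` this controls `w` up to the midpoint of `[r, 1]`.
Doubling is sufficient: Cauchy's formula on circles of radius `(1 - r) / 2`, averaged over
rotations, bounds the mean of `f'` at `r` by `2 / (1 - r)` times a bound for the means of `f` up to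
the midpoint (`mul_mean_deriv_le`). -/

namespace HardyGrowth

/-! ### Boundedness implies doubling -/

/-- If `ρ ^ n / w ρ` is maximal at `b`, then by convexity the slope of `log w` with respect to `log ρ`
is at most `n` to the left of `b`, which bounds the growth of `w` there. -/
theorem IsLogConvex.le_mul_exp_of_isMax {w : ℝ → ℝ} (hw : IsWeight w) (hlog : IsLogConvex w)
    {n : ℕ} {b : ℝ} (hb0 : 0 < b) (hb1 : b < 1)
    (hmax : ∀ r ∈ Ico (0 : ℝ) 1, r ^ n / w r ≤ b ^ n / w b)
    {r s : ℝ} (hr : 0 < r) (hrs : r < s) (hsb : s ≤ b) :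
    w s ≤ w r * Real.exp (n * ((s - r) / r)) := by
  have hs : 0 < s := hr.trans hrs
  have hrb : r < b := hrs.trans_le hsb
  have wr := hw.pos r ⟨hr.le, hrb.trans hb1⟩
  have ws := hw.pos s ⟨hs.le, hsb.trans_lt hb1⟩
  have wb := hw.pos b ⟨hb0.le, hb1⟩
  have lrs : Real.log r < Real.log s := Real.log_lt_log hr hrs
  have lsb : Real.log s ≤ Real.log b := Real.log_le_log hs hsb
  have lb : Real.log b < 0 := Real.log_neg hb0 hb1
  have key := ConvexOn.secant_mono hlog (a := Real.log r) (x := Real.log s) (y := Real.log b)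
    (by simp only [mem_Iio]; linarith) (by simp only [mem_Iio]; linarith) lb
    lrs.ne' (lrs.trans_le lsb).ne' lsb
  simp only [Real.exp_log hr, Real.exp_log hs, Real.exp_log hb0] at key
  have hm := Real.log_le_log (by positivity) (hmax r ⟨hr.le, hrb.trans hb1⟩)
  rw [Real.log_div (by positivity) wr.ne', Real.log_div (by positivity) wb.ne', Real.log_pow,
    Real.log_pow] at hm
  have h2 : (Real.log (w b) - Real.log (w r)) / (Real.log b - Real.log r) ≤ n := by
    rw [div_le_iff₀ (by linarith)]
    linarith
  have h3 := key.trans h2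
  rw [div_le_iff₀ (by linarith)] at h3
  have h4 : Real.log s - Real.log r ≤ (s - r) / r := by
    rw [← Real.log_div hs.ne' hr.ne', sub_div, div_self hr.ne']
    exact Real.log_le_sub_one_of_pos (by positivity)
  have h5 : Real.log (w s) ≤ Real.log (w r) + n * ((s - r) / r) := by
    have := mul_le_mul_of_nonneg_left h4 (Nat.cast_nonneg (α := ℝ) n)
    linarith
  rw [← Real.exp_log ws]
  calc Real.exp (Real.log (w s)) ≤ _ := Real.exp_le_exp.2 h5
    _ = _ := by rw [Real.exp_add, Real.exp_log wr]

/-- Since `w` is unbounded, the quotient falls below its value at `1 / 2` near `1`, so a maximum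
over a compact `[0, c]` is global. -/
theorem IsWeight.exists_isMax_pow_div {w : ℝ → ℝ} (hw : IsWeight w) {n : ℕ} (hn : n ≠ 0) :
    ∃ b : ℝ, 0 < b ∧ b < 1 ∧ ∀ r ∈ Ico (0 : ℝ) 1, r ^ n / w r ≤ b ^ n / w b := by
  have w2 := hw.pos (1 / 2) ⟨by norm_num, by norm_num⟩
  obtain ⟨c, hc, hc1⟩ : ∃ c ∈ Ico (0 : ℝ) 1, w (1 / 2) / (1 / 2) ^ n < w c := by
    by_contra! h
    exact hw.unbounded ⟨_, by rintro _ ⟨c, hc, rfl⟩; exact h c hc⟩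
  have wc := hw.pos c hc
  have hpos : (0 : ℝ) < (1 / 2) ^ n / w (1 / 2) := by positivity
  have htail : ∀ r ∈ Ico (0 : ℝ) 1, c ≤ r → r ^ n / w r < (1 / 2) ^ n / w (1 / 2) := by
    intro r hr hcr
    have wr := hw.pos r hr
    have h1 : w c ≤ w r := hw.mono hc hr hcr
    have h2 : r ^ n ≤ 1 := pow_le_one₀ hr.1 hr.2.le
    rw [div_lt_iff₀ (by positivity)] at hc1
    rw [div_lt_div_iff₀ wr w2]
    have h3 : (0 : ℝ) < (1 / 2) ^ n := by positivity
    nlinarith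
  have hc2 : 1 / 2 ≤ c := by
    by_contra! h
    exact lt_irrefl _ (htail (1 / 2) ⟨by norm_num, by norm_num⟩ h.le)
  have hsub : Icc 0 c ⊆ Ico (0 : ℝ) 1 := fun r hr => ⟨hr.1, hr.2.trans_lt hc.2⟩
  obtain ⟨b, hb, hbmax⟩ := isCompact_Icc.exists_isMaxOn (⟨0, le_rfl, hc.1⟩ : (Icc 0 c).Nonempty)
    (((continuousOn_id.pow n).div hw.cont fun r hr => (hw.pos r hr).ne').mono hsub)
  have hb' : ∀ r ∈ Icc 0 c, r ^ n / w r ≤ b ^ n / w b := hbmax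
  have h2 := hb' (1 / 2) ⟨by norm_num, hc2⟩
  refine ⟨b, lt_of_le_of_ne hb.1 ?_, (hsub hb).2, fun r hr => ?_⟩
  · rintro rfl
    rw [zero_pow hn, zero_div] at h2
    linarith
  · rcases le_total r c with h | h
    · exact hb' r ⟨hr.1, h⟩
    · exact (htail r hr h).le.trans h2

theorem mean_eq_of_norm_eq {p : ℝ≥0∞} (hp : 1 ≤ p) {f : ℂ → ℂ} {r c : ℝ} (hc : 0 ≤ c)
    (h : ∀ θ : ℝ, ‖f (r * Complex.exp (θ * Complex.I))‖ = c) : mean p f r = c := by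
  have hpi := Real.pi_pos
  unfold mean
  simp only [h]
  split_ifs with hp'
  · rw [Set.Nonempty.image_const (nonempty_Ico.2 (by positivity)), csSup_singleton]
  · have : p.toReal ≠ 0 := (ENNReal.toReal_pos (by positivity) hp').ne'
    rw [intervalIntegral.integral_const, smul_eq_mul, sub_zero, one_div,
      inv_mul_cancel_left₀ (by positivity), one_div, Real.rpow_rpow_inv hc this]

theorem mean_pow {p : ℝ≥0∞} (hp : 1 ≤ p) (n : ℕ) {r : ℝ} (hr : 0 ≤ r) :
    mean p (fun z => z ^ n) r = r ^ n :=
  mean_eq_of_norm_eq hp (by positivity) fun θ => by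
    simp [Complex.norm_exp_ofReal_mul_I, abs_of_nonneg hr]

theorem mean_deriv_pow {p : ℝ≥0∞} (hp : 1 ≤ p) (n : ℕ) {r : ℝ} (hr : 0 ≤ r) :
    mean p (deriv fun z => z ^ n) r = n * r ^ (n - 1) :=
  mean_eq_of_norm_eq hp (by positivity) fun θ => by
    simp [Complex.norm_exp_ofReal_mul_I, abs_of_nonneg hr]

/-- Testing the boundedness of differentiation on monomials. -/
theorem DiffBounded.exists_isMax_pow_div {p : ℝ≥0∞} (hp : 1 ≤ p) {w u : ℝ → ℝ} (hw : IsWeight w)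
    (hu : ∀ r ∈ Ico (0 : ℝ) 1, u r = w r / (1 - r)) (h : DiffBounded p w u) :
    ∃ C : ℝ, 1 ≤ C ∧ ∀ n : ℕ, n ≠ 0 → ∃ b : ℝ, 0 < b ∧ b < 1 ∧ n * (1 - b) ≤ C ∧
      ∀ r ∈ Ico (0 : ℝ) 1, r ^ n / w r ≤ b ^ n / w b := by
  obtain ⟨C, hC⟩ := h
  refine ⟨max C 1, le_max_right _ _, fun n hn => ?_⟩
  obtain ⟨b, hb0, hb1, hb⟩ := hw.exists_isMax_pow_div hn
  refine ⟨b, hb0, hb1, ?_, hb⟩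
  have wb := hw.pos b ⟨hb0.le, hb1⟩
  have hbound : ∀ x ∈ quotients p w (fun z => z ^ n), x ≤ b ^ n / w b := by
    rintro _ ⟨r, hr, rfl⟩
    simpa only [mean_pow hp n hr.1] using hb r hr
  obtain ⟨hD, hN⟩ := hC (fun z => z ^ n)
    ⟨(differentiable_id.pow n).differentiableOn, _, hbound⟩
  have hne : (quotients p w (fun z => z ^ n)).Nonempty := ⟨_, 0, ⟨le_rfl, one_pos⟩, rfl⟩
  have h1 : growthNorm p w (fun z => z ^ n) = b ^ n / w b :=
    le_antisymm (csSup_le hne hbound)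
      (le_csSup ⟨_, hbound⟩ ⟨b, ⟨hb0.le, hb1⟩, by simp only [mean_pow hp n hb0.le]⟩)
  -- The norm of `z ^ n` is attained at `b`; evaluating the derivative's quotient at the same radius
  -- makes the factors `w b` cancel.
  have h2 : n * b ^ (n - 1) / (w b / (1 - b)) ≤ growthNorm p u (deriv fun z => z ^ n) :=
    le_csSup hD.2 ⟨b, ⟨hb0.le, hb1⟩, by
      simp only [mean_deriv_pow hp n hb0.le, hu b ⟨hb0.le, hb1⟩]⟩
  have h3 := h2.trans hN
  rw [h1] at h3
  have hb1' : 0 < 1 - b := sub_pos.2 hb1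
  have e1 : n * b ^ (n - 1) / (w b / (1 - b)) = b ^ (n - 1) / w b * (n * (1 - b)) := by
    field_simp
  have e2 : C * (b ^ n / w b) = b ^ (n - 1) / w b * (C * b) := by
    obtain ⟨m, rfl⟩ := Nat.exists_eq_succ_of_ne_zero hn
    simp only [Nat.succ_eq_add_one, Nat.add_sub_cancel, pow_succ]
    ring
  rw [e1, e2] at h3
  have h4 := le_of_mul_le_mul_left h3 (by positivity)
  calc n * (1 - b) ≤ C * b := h4
    _ ≤ max C 1 * b := by gcongr; exact le_max_left _ _
    _ ≤ max C 1 := mul_le_of_le_one_right (by positivity) hb1.le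

/-- If differentiation is bounded for one exponent, the weight is doubling. -/
theorem DiffBounded.exists_doubling {p : ℝ≥0∞} (hp : 1 ≤ p) {w u : ℝ → ℝ} (hw : IsWeight w)
    (hlog : IsLogConvex w) (hu : ∀ r ∈ Ico (0 : ℝ) 1, u r = w r / (1 - r))
    (h : DiffBounded p w u) : ∃ K : ℝ, ∀ r ∈ Ico (0 : ℝ) 1, w (r + (1 - r) / 2) ≤ K * w r := by
  obtain ⟨C, hC1, hC⟩ := h.exists_isMax_pow_div hp hw hu
  have m0 : (0 : ℝ) ∈ Ico (0 : ℝ) 1 := ⟨le_rfl, one_pos⟩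
  have m3 : (3 / 4 : ℝ) ∈ Ico (0 : ℝ) 1 := ⟨by norm_num, by norm_num⟩
  have w0 := hw.pos 0 m0
  -- The exponential estimate degenerates as `r → 0`, so monotonicity covers `r ≤ 1 / 2`, where the
  -- midpoint is at most `3 / 4`.
  refine ⟨max (w (3 / 4) / w 0) (Real.exp (2 * C + 1)), fun r hr => ?_⟩
  have wr := hw.pos r hr
  have hr1 : 0 < 1 - r := sub_pos.2 hr.2
  have mr : r + (1 - r) / 2 ∈ Ico (0 : ℝ) 1 := ⟨by linarith [hr.1], by linarith⟩
  rcases le_total r (1 / 2) with h2 | h2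
  · calc w (r + (1 - r) / 2) ≤ w (3 / 4) := hw.mono mr m3 (by linarith)
      _ = w (3 / 4) / w 0 * w 0 := by field_simp
      _ ≤ w (3 / 4) / w 0 * w r := by
        have := hw.pos _ m3
        gcongr
        exact hw.mono m0 hr hr.1
      _ ≤ _ := by gcongr; exact le_max_left _ _
  · have hr0 : 0 < r := by linarith
    -- This `n` gives `C ≤ n * (1 - r) / 2`, so `n * (1 - b) ≤ C` forces `b` past the midpoint;
    -- rounding up costs only the `+ 1` in the exponent.
    set n : ℕ := ⌈2 * C / (1 - r)⌉₊ with hn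
    have hpos : 0 < 2 * C / (1 - r) := by positivity
    have hle : 2 * C / (1 - r) ≤ n := Nat.le_ceil _
    have hlt : (n : ℝ) < 2 * C / (1 - r) + 1 := Nat.ceil_lt_add_one hpos.le
    have hn0 : (0 : ℝ) < n := hpos.trans_le hle
    obtain ⟨b, hb0, hb1, hnb, hb⟩ := hC n (by exact_mod_cast hn0.ne')
    rw [div_le_iff₀ hr1] at hle
    have hsb : r + (1 - r) / 2 ≤ b := by
      have : n * (1 - b) ≤ n * ((1 - r) / 2) := by linarith
      have := le_of_mul_le_mul_left this hn0
      linarith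
    have key := hlog.le_mul_exp_of_isMax hw hb0 hb1 hb hr0 (by linarith) hsb
    refine key.trans ?_
    rw [mul_comm]
    gcongr
    refine le_trans (Real.exp_le_exp.2 ?_) (le_max_right _ _)
    rw [add_sub_cancel_left, ← mul_div_assoc, div_le_iff₀ hr0]
    have : (n : ℝ) * (1 - r) ≤ 2 * C + (1 - r) := by
      have := mul_le_mul_of_nonneg_right hlt.le hr1.le
      rwa [add_mul, div_mul_cancel₀ _ hr1.ne', one_mul] at this
    nlinarith

/-! ### Integral means of the derivative -/

theorem norm_circleMap_ofReal_le {r s : ℝ} (hr : 0 ≤ r) (hs : 0 ≤ s) (t : ℝ) :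
    ‖circleMap r s t‖ ≤ r + s := by
  refine (norm_add_le _ _).trans ?_
  simp [Complex.norm_exp_ofReal_mul_I, abs_of_nonneg hr, abs_of_nonneg hs]

/-- Cauchy's estimate for the derivative by an average over a circle, in rotated coordinates. -/
theorem mul_norm_deriv_le {f : ℂ → ℂ} (hf : DifferentiableOn ℂ f (Metric.ball 0 1)) {r s : ℝ}
    (hr : 0 ≤ r) (hs : 0 < s) (hrs : r + s < 1) (θ : ℝ) :
    s * ‖deriv f (r * Complex.exp (θ * Complex.I))‖ ≤ 1 / (2 * Real.pi) *
      ∫ t in (0 : ℝ)..(2 * Real.pi), ‖f (circleMap r s t * Complex.exp (θ * Complex.I))‖ := by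
  have hpi := Real.pi_pos
  set e := Complex.exp (θ * Complex.I) with he
  have hne : ‖e‖ = 1 := Complex.norm_exp_ofReal_mul_I θ
  -- Rotating `f` instead of the centre keeps the Cauchy circle independent of `θ`, so the variables
  -- `t` and `θ` separate.
  have hd : DifferentiableOn ℂ (fun z => f (e * z)) (Metric.closedBall (r : ℂ) s) := by
    refine hf.comp (differentiable_id.const_mul e).differentiableOn fun z hz => ?_
    rw [mem_ball_zero_iff, norm_mul, hne, one_mul]
    rw [mem_closedBall_iff_norm] at hz
    calc ‖z‖ = ‖(z - r) + r‖ := by rw [sub_add_cancel]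
      _ ≤ ‖z - r‖ + ‖(r : ℂ)‖ := norm_add_le _ _
      _ < 1 := by rw [Complex.norm_of_nonneg hr]; linarith
  have hC := hd.deriv_eq_smul_circleIntegral hs
  rw [deriv_comp_mul_left] at hC
  have hn := congrArg norm hC
  rw [norm_smul, norm_smul, hne, one_mul, mul_comm e] at hn
  have h1 : ‖∮ z in C((r : ℂ), s), (1 / (z - r) ^ 2) • f (e * z)‖ ≤
      ∫ t in (0 : ℝ)..(2 * Real.pi), s⁻¹ * ‖f (circleMap r s t * e)‖ := by
    unfold circleIntegral
    refine (intervalIntegral.norm_integral_le_integral_norm (by positivity)).trans_eq ?_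
    congr 1 with t
    simp only [deriv_circleMap, norm_smul, norm_mul, norm_circleMap_zero, Complex.norm_I,
      circleMap_sub_center, norm_div, norm_pow, norm_one, abs_of_pos hs, mul_comm e]
    field_simp
  rw [hn, intervalIntegral.integral_const_mul] at h1
  have h2 : ‖(2 * Real.pi * Complex.I : ℂ)‖ = 2 * Real.pi := by
    simp [abs_of_pos hpi]
  rw [h2] at h1
  calc s * ‖deriv f (r * e)‖
      = s * (1 / (2 * Real.pi)) * (2 * Real.pi * ‖deriv f (r * e)‖) := by field_simp
    _ ≤ s * (1 / (2 * Real.pi)) *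
        (s⁻¹ * ∫ t in (0 : ℝ)..(2 * Real.pi), ‖f (circleMap r s t * e)‖) := by gcongr
    _ = _ := by rw [mul_comm s, mul_assoc, mul_inv_cancel_left₀ hs.ne']

/-- Jensen's inequality for powers of circle averages. -/
theorem rpow_average_le {q : ℝ} (hq : 1 ≤ q) {g : ℝ → ℝ} (hg : Continuous g) (h0 : ∀ t, 0 ≤ g t) :
    (1 / (2 * Real.pi) * ∫ t in (0 : ℝ)..(2 * Real.pi), g t) ^ q ≤
      1 / (2 * Real.pi) * ∫ t in (0 : ℝ)..(2 * Real.pi), g t ^ q := by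
  have hpi := Real.pi_pos
  have hgq : Continuous fun t => g t ^ q :=
    hg.rpow_const fun t => Or.inr (zero_le_one.trans hq)
  have := (convexOn_rpow hq).map_set_average_le (μ := MeasureTheory.volume)
    (t := uIoc 0 (2 * Real.pi)) (f := g)
    (continuousOn_id.rpow_const fun x _ => Or.inr (zero_le_one.trans hq)) isClosed_Ici
    (by simp [hpi.ne'])
    (by rw [Real.volume_uIoc]; exact ENNReal.ofReal_ne_top) (Filter.Eventually.of_forall h0)
    ((hg.integrableOn_uIcc (a := 0) (b := 2 * Real.pi)).mono_set uIoc_subset_uIcc)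
    ((hgq.integrableOn_uIcc (a := 0) (b := 2 * Real.pi)).mono_set uIoc_subset_uIcc)
  simpa only [interval_average_eq, sub_zero, smul_eq_mul, one_div] using this

/-- The argument of `ζ` only shifts `θ`, and the integral runs over a full period. -/
theorem integral_comp_mul_exp (g : ℂ → ℝ) (ζ : ℂ) :
    ∫ θ in (0 : ℝ)..(2 * Real.pi), g (ζ * Complex.exp (θ * Complex.I)) =
      ∫ θ in (0 : ℝ)..(2 * Real.pi), g (‖ζ‖ * Complex.exp (θ * Complex.I)) := by
  have hper : Function.Periodic (fun θ : ℝ => g (‖ζ‖ * Complex.exp (θ * Complex.I)))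
      (2 * Real.pi) := fun θ => by
    push_cast
    rw [add_mul, Complex.exp_add, Complex.exp_two_pi_mul_I, mul_one]
  have h1 := hper.intervalIntegral_add_eq ζ.arg 0
  rw [zero_add] at h1
  rw [← h1]
  have h2 := intervalIntegral.integral_comp_add_right (a := 0) (b := 2 * Real.pi)
    (fun θ : ℝ => g (‖ζ‖ * Complex.exp (θ * Complex.I))) ζ.arg
  rw [zero_add, add_comm] at h2
  rw [← h2]
  congr 1 with θ
  conv_lhs => rw [← Complex.norm_mul_exp_arg_mul_I ζ]
  push_cast
  rw [add_mul, Complex.exp_add, mul_assoc, mul_comm (Complex.exp (ζ.arg * Complex.I))]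

theorem continuous_comp_of_norm_lt_one {f : ℂ → ℂ} (hf : ContinuousOn f (Metric.ball 0 1))
    {X : Type*} [TopologicalSpace X] {g : X → ℂ} (hg : Continuous g) (h : ∀ x, ‖g x‖ < 1) :
    Continuous fun x => f (g x) :=
  hf.comp_continuous hg fun x => by rw [mem_ball_zero_iff]; exact h x

theorem norm_le_mean_top {f : ℂ → ℂ} (hf : ContinuousOn f (Metric.ball 0 1)) {ζ : ℂ}
    (hζ : ‖ζ‖ < 1) : ‖f ζ‖ ≤ mean ∞ f ‖ζ‖ := by
  have hpi := Real.pi_pos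
  unfold mean
  rw [if_pos rfl]
  have hcont : Continuous fun θ : ℝ => ‖f (‖ζ‖ * Complex.exp (θ * Complex.I))‖ :=
    (continuous_comp_of_norm_lt_one hf (by fun_prop) fun θ => by
      simpa [Complex.norm_exp_ofReal_mul_I] using hζ).norm
  refine le_csSup ((isCompact_Icc.bddAbove_image hcont.continuousOn).mono
    (image_mono Ico_subset_Icc_self)) ?_
  -- `Complex.arg` takes values in `(-π, π]`, so it is reduced to `[0, 2π)`.
  refine ⟨toIcoMod Real.two_pi_pos 0 ζ.arg, by simpa using toIcoMod_mem_Ico Real.two_pi_pos 0 ζ.arg,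
    ?_⟩
  have : Complex.exp (toIcoMod Real.two_pi_pos 0 ζ.arg * Complex.I) =
      Complex.exp (ζ.arg * Complex.I) := by
    rw [Complex.exp_eq_exp_iff_exists_int]
    refine ⟨-toIcoDiv Real.two_pi_pos 0 ζ.arg, ?_⟩
    simp only [toIcoMod, zsmul_eq_mul]
    push_cast
    ring
  simp only [this, Complex.norm_mul_exp_arg_mul_I]

theorem mean_nonneg (p : ℝ≥0∞) (f : ℂ → ℂ) (r : ℝ) : 0 ≤ mean p f r := by
  have hpi := Real.pi_pos
  unfold mean
  split_ifs
  · exact Real.sSup_nonneg (by rintro _ ⟨θ, -, rfl⟩; exact norm_nonneg _)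
  · refine Real.rpow_nonneg (mul_nonneg (by positivity) ?_) _
    exact intervalIntegral.integral_nonneg (by positivity) fun θ _ => by positivity

theorem mul_mean_top_deriv_le {f : ℂ → ℂ} (hf : DifferentiableOn ℂ f (Metric.ball 0 1)) {r s B : ℝ}
    (hr : 0 ≤ r) (hs : 0 < s) (hrs : r + s < 1) (hB : ∀ ρ ∈ Icc 0 (r + s), mean ∞ f ρ ≤ B) :
    s * mean ∞ (deriv f) r ≤ B := by
  have hpi := Real.pi_pos
  rw [mul_comm, ← le_div_iff₀ hs]
  nth_rw 1 [mean]
  rw [if_pos rfl]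
  refine csSup_le (Set.Nonempty.image _ ⟨0, le_rfl, by positivity⟩) ?_
  rintro _ ⟨θ, -, rfl⟩
  simp only
  rw [le_div_iff₀ hs, mul_comm]
  refine (mul_norm_deriv_le hf hr hs hrs θ).trans ?_
  have hlt : ∀ t, ‖circleMap r s t * Complex.exp (θ * Complex.I)‖ ≤ r + s := fun t => by
    rw [norm_mul, Complex.norm_exp_ofReal_mul_I, mul_one]
    exact norm_circleMap_ofReal_le hr hs.le t
  have hle : ∀ t, ‖f (circleMap r s t * Complex.exp (θ * Complex.I))‖ ≤ B := fun t =>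
    (norm_le_mean_top hf.continuousOn ((hlt t).trans_lt hrs)).trans (hB _ ⟨norm_nonneg _, hlt t⟩)
  have hcont : Continuous fun t => ‖f (circleMap r s t * Complex.exp (θ * Complex.I))‖ :=
    (continuous_comp_of_norm_lt_one hf.continuousOn (by fun_prop)
      fun t => (hlt t).trans_lt hrs).norm
  have : ∫ t in (0 : ℝ)..(2 * Real.pi), ‖f (circleMap r s t * Complex.exp (θ * Complex.I))‖ ≤
      ∫ _ in (0 : ℝ)..(2 * Real.pi), B :=
    intervalIntegral.integral_mono_on (by positivity) (hcont.intervalIntegrable _ _) (by simp)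
      fun t _ => hle t
  rw [intervalIntegral.integral_const, smul_eq_mul, sub_zero] at this
  calc _ ≤ 1 / (2 * Real.pi) * (2 * Real.pi * B) := by gcongr
    _ = B := by field_simp

/-- Minkowski's integral inequality for functions on the circle, in terms of integrals of powers. -/
theorem integral_rpow_le_of_le_average {q : ℝ} (hq : 1 ≤ q) {D : ℝ → ℝ} {G : ℝ → ℝ → ℝ} {A : ℝ}
    (hD : Continuous D) (hG : Continuous fun x : ℝ × ℝ => G x.1 x.2) (hD0 : ∀ θ, 0 ≤ D θ)
    (hG0 : ∀ θ t, 0 ≤ G θ t)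
    (hDG : ∀ θ, D θ ≤ 1 / (2 * Real.pi) * ∫ t in (0 : ℝ)..(2 * Real.pi), G θ t)
    (hA : ∀ t, ∫ θ in (0 : ℝ)..(2 * Real.pi), G θ t ^ q ≤ A) :
    ∫ θ in (0 : ℝ)..(2 * Real.pi), D θ ^ q ≤ A := by
  have hpi := Real.pi_pos
  have hq0 : 0 ≤ q := by linarith
  have hDq : Continuous fun θ => D θ ^ q := hD.rpow_const fun _ => Or.inr hq0
  have hGq : Continuous fun x : ℝ × ℝ => G x.1 x.2 ^ q := hG.rpow_const fun _ => Or.inr hq0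
  have hswap := MeasureTheory.intervalIntegral_intervalIntegral_swap (a := 0) (b := 2 * Real.pi)
    (c := 0) (d := 2 * Real.pi) (F := fun θ t => G θ t ^ q)
    ((hGq.continuousOn.integrableOn_compact (isCompact_uIcc.prod isCompact_uIcc)).mono_set
      (prod_mono uIoc_subset_uIcc uIoc_subset_uIcc))
  have hc1 : Continuous fun θ : ℝ => ∫ t in (0 : ℝ)..(2 * Real.pi), G θ t ^ q :=
    intervalIntegral.continuous_parametric_intervalIntegral_of_continuous' hGq _ _
  have hc2 : Continuous fun t : ℝ => ∫ θ in (0 : ℝ)..(2 * Real.pi), G θ t ^ q :=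
    intervalIntegral.continuous_parametric_intervalIntegral_of_continuous'
      (f := fun t θ : ℝ => G θ t ^ q) (hGq.comp continuous_swap) _ _
  have h1 : ∫ t in (0 : ℝ)..(2 * Real.pi), ∫ θ in (0 : ℝ)..(2 * Real.pi), G θ t ^ q ≤
      ∫ _ in (0 : ℝ)..(2 * Real.pi), A :=
    intervalIntegral.integral_mono_on (by positivity) (hc2.intervalIntegrable _ _) (by simp)
      fun t _ => hA t
  rw [intervalIntegral.integral_const, smul_eq_mul, sub_zero] at h1
  -- Jensen for each `θ`; swapping the integrals then lets the bound `A`, uniform in `t`, be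
  -- averaged over `t`.
  refine (intervalIntegral.integral_mono_on (by positivity) (hDq.intervalIntegrable _ _)
    ((hc1.const_mul (1 / (2 * Real.pi))).intervalIntegrable _ _) fun θ _ =>
      (Real.rpow_le_rpow (hD0 θ) (hDG θ) hq0).trans
        (rpow_average_le hq (hG.comp (Continuous.prodMk_right θ)) (hG0 θ))).trans ?_
  rwa [intervalIntegral.integral_const_mul, hswap, one_div, inv_mul_le_iff₀ (by positivity)]

theorem integral_rpow_norm_deriv_le {q : ℝ} (hq : 1 ≤ q) {f : ℂ → ℂ}
    (hf : DifferentiableOn ℂ f (Metric.ball 0 1)) {r s A : ℝ} (hr : 0 ≤ r) (hs : 0 < s)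
    (hrs : r + s < 1) (hA : ∀ t : ℝ, ∫ θ in (0 : ℝ)..(2 * Real.pi),
      ‖f (circleMap r s t * Complex.exp (θ * Complex.I))‖ ^ q ≤ A) :
    s ^ q * ∫ θ in (0 : ℝ)..(2 * Real.pi),
      ‖deriv f (r * Complex.exp (θ * Complex.I))‖ ^ q ≤ A := by
  have hlt : ∀ t θ : ℝ, ‖circleMap r s t * Complex.exp (θ * Complex.I)‖ < 1 := fun t θ => by
    rw [norm_mul, Complex.norm_exp_ofReal_mul_I, mul_one]
    exact (norm_circleMap_ofReal_le hr hs.le t).trans_lt hrs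
  have hgc : Continuous fun x : ℝ × ℝ => circleMap r s x.2 * Complex.exp (x.1 * Complex.I) :=
    ((continuous_circleMap (r : ℂ) s).comp continuous_snd).mul (by fun_prop)
  have hG := (continuous_comp_of_norm_lt_one hf.continuousOn hgc fun x => hlt x.2 x.1).norm
  have hec : Continuous fun θ : ℝ => (r : ℂ) * Complex.exp (θ * Complex.I) := by fun_prop
  have hD := (continuous_comp_of_norm_lt_one (hf.deriv Metric.isOpen_ball).continuousOn hec
    fun θ => by
      rw [norm_mul, Complex.norm_exp_ofReal_mul_I, mul_one, Complex.norm_of_nonneg hr]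
      linarith).norm
  have := integral_rpow_le_of_le_average hq
    (G := fun θ t => ‖f (circleMap r s t * Complex.exp (θ * Complex.I))‖)
    (hD.const_mul s) hG (fun θ => by positivity) (fun θ t => norm_nonneg _)
    (mul_norm_deriv_le hf hr hs hrs) hA
  simpa only [Real.mul_rpow hs.le (norm_nonneg _), intervalIntegral.integral_const_mul] using this

theorem integral_rpow_nonneg (g : ℝ → ℂ) (q : ℝ) :
    0 ≤ ∫ θ in (0 : ℝ)..(2 * Real.pi), ‖g θ‖ ^ q :=
  intervalIntegral.integral_nonneg Real.two_pi_pos.le fun _ _ =>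
    Real.rpow_nonneg (norm_nonneg _) _

theorem mean_le_iff {p : ℝ≥0∞} (hp : 1 ≤ p) (hp' : p ≠ ∞) (f : ℂ → ℂ) (r : ℝ) {B : ℝ}
    (hB : 0 ≤ B) : mean p f r ≤ B ↔ ∫ θ in (0 : ℝ)..(2 * Real.pi),
      ‖f (r * Complex.exp (θ * Complex.I))‖ ^ p.toReal ≤ 2 * Real.pi * B ^ p.toReal := by
  have hpos : 0 < p.toReal := ENNReal.toReal_pos (zero_lt_one.trans_le hp).ne' hp'
  have h0 := integral_rpow_nonneg (fun θ => f (r * Complex.exp (θ * Complex.I))) p.toReal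
  rw [mean, if_neg hp', one_div p.toReal, Real.rpow_inv_le_iff_of_pos
    (mul_nonneg (one_div_nonneg.2 Real.two_pi_pos.le) h0) hB hpos, one_div,
    inv_mul_le_iff₀ Real.two_pi_pos]

/-- For fixed `t`, rotation sweeps the circle of radius `‖circleMap r s t‖ ≤ r + s`. Bounding the
means at all radii up to `r + s` avoids proving that they increase with the radius. -/
theorem mul_mean_deriv_le_of_ne_top {p : ℝ≥0∞} (hp : 1 ≤ p) (hp' : p ≠ ∞) {f : ℂ → ℂ}
    (hf : DifferentiableOn ℂ f (Metric.ball 0 1)) {r s B : ℝ} (hr : 0 ≤ r) (hs : 0 < s)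
    (hrs : r + s < 1) (hB : ∀ ρ ∈ Icc 0 (r + s), mean p f ρ ≤ B) :
    s * mean p (deriv f) r ≤ B := by
  have hB0 : 0 ≤ B := (mean_nonneg p f 0).trans (hB 0 ⟨le_rfl, by positivity⟩)
  have hq : 1 ≤ p.toReal := by simpa using ENNReal.toReal_mono hp' hp
  have h1 := integral_rpow_norm_deriv_le hq hf hr hs hrs (A := 2 * Real.pi * B ^ p.toReal)
    fun t => by
      rw [integral_comp_mul_exp (fun z => ‖f z‖ ^ p.toReal)]
      exact (mean_le_iff hp hp' f _ hB0).1
        (hB ‖circleMap r s t‖ ⟨norm_nonneg _, norm_circleMap_ofReal_le hr hs.le t⟩)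
  rw [mul_comm, ← le_div_iff₀ hs, mean_le_iff hp hp' _ _ (div_nonneg hB0 hs.le),
    Real.div_rpow hB0 hs.le, mul_div_assoc', le_div_iff₀ (Real.rpow_pos_of_pos hs _), mul_comm]
  exact h1

theorem mul_mean_deriv_le {p : ℝ≥0∞} (hp : 1 ≤ p) {f : ℂ → ℂ}
    (hf : DifferentiableOn ℂ f (Metric.ball 0 1)) {r s B : ℝ} (hr : 0 ≤ r) (hs : 0 < s)
    (hrs : r + s < 1) (hB : ∀ ρ ∈ Icc 0 (r + s), mean p f ρ ≤ B) :
    s * mean p (deriv f) r ≤ B := by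
  by_cases hp' : p = ∞
  · subst hp'
    exact mul_mean_top_deriv_le hf hr hs hrs hB
  · exact mul_mean_deriv_le_of_ne_top hp hp' hf hr hs hrs hB

/-! ### Doubling implies boundedness -/

/-- Differentiation is bounded if the weight is doubling. -/
theorem diffBounded_of_doubling {p : ℝ≥0∞} (hp : 1 ≤ p) {w u : ℝ → ℝ} (hw : IsWeight w)
    (hu : ∀ r ∈ Ico (0 : ℝ) 1, u r = w r / (1 - r)) {K : ℝ}
    (hK : ∀ r ∈ Ico (0 : ℝ) 1, w (r + (1 - r) / 2) ≤ K * w r) : DiffBounded p w u := by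
  refine ⟨2 * K, fun f hf => ?_⟩
  set N := growthNorm p w f with hN
  have hquot : ∀ r ∈ Ico (0 : ℝ) 1, mean p f r ≤ N * w r := fun r hr => by
    rw [← div_le_iff₀ (hw.pos r hr)]
    exact le_csSup hf.2 ⟨r, hr, rfl⟩
  have m0 : (0 : ℝ) ∈ Ico (0 : ℝ) 1 := ⟨le_rfl, one_pos⟩
  have hN0 : 0 ≤ N :=
    nonneg_of_mul_nonneg_left ((mean_nonneg p f 0).trans (hquot 0 m0)) (hw.pos 0 m0)
  have hbound : ∀ x ∈ quotients p u (deriv f), x ≤ 2 * K * N := by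
    rintro _ ⟨r, hr, rfl⟩
    have wr := hw.pos r hr
    have hr1 : 0 < 1 - r := sub_pos.2 hr.2
    have hs : r + (1 - r) / 2 < 1 := by linarith
    -- Monotonicity of `w` makes its value at the midpoint serve all smaller radii; the radius `(1 -
    -- r) / 2` produces the factor `2` in `2 * K`.
    have key := mul_mean_deriv_le (B := N * w (r + (1 - r) / 2)) hp hf.1 hr.1 (half_pos hr1) hs
      fun ρ hρ => (hquot ρ ⟨hρ.1, hρ.2.trans_lt hs⟩).trans <| mul_le_mul_of_nonneg_left
        (hw.mono ⟨hρ.1, hρ.2.trans_lt hs⟩ ⟨hρ.1.trans hρ.2, hs⟩ hρ.2) hN0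
    have key2 := key.trans (mul_le_mul_of_nonneg_left (hK r hr) hN0)
    simp only [hu r hr]
    rw [div_le_iff₀ (by positivity), mul_div_assoc', le_div_iff₀ hr1]
    linarith
  exact ⟨⟨hf.1.deriv Metric.isOpen_ball, _, hbound⟩,
    csSup_le ⟨_, 0, m0, rfl⟩ hbound⟩

end HardyGrowth

theorem mainTheorem6 (w u : ℝ → ℝ) (hw : HardyGrowth.IsWeight w)
    (hlog : HardyGrowth.IsLogConvex w)
    (hu : ∀ r ∈ Set.Ico (0 : ℝ) 1, u r = w r / (1 - r))
    (hbdd : ∃ p : ℝ≥0∞, 1 ≤ p ∧ HardyGrowth.DiffBounded p w u) :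
    ∀ p : ℝ≥0∞, 1 ≤ p → HardyGrowth.DiffBounded p w u := by
  obtain ⟨p₀, hp₀, h⟩ := hbdd
  obtain ⟨K, hK⟩ := h.exists_doubling hp₀ hw hlog hu
  exact fun p hp => HardyGrowth.diffBounded_of_doubling hp hw hu hK
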